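/- A (finite) Markov decision process is a tuple $\mathcal M=(S,A,\delta)$ with finite sets $S$ of states and $A$ of actions and a partial function $\delta$ from $S\times A$ to the rational probability distributions on $S$, such that for every state $s$ the set $A(s)$ of actions $a$ for which $\delta(s,a)$ is defined is non-empty. A run is a sequence $\rho=s_0a_0s_1a_1\ldots$ such that, for all $i$, $\delta(s_i,a_i)$ is defined and $\delta(s_i,a_i)(s_{i+1})>0$; its suffix from the $n$-th state is $\rho[n,\infty]=s_na_ns_{n+1}a_{n+1}\ldots$. Histories are the finite prefixes $s_0a_0\ldots a_{n-1}s_n$ of runs. A strategy $\sigma$ maps every history ending in a state $s$ to a rational probability distribution on $A$ supported in $A(s)$. It is pure if all these distributions are Dirac. It is finite-memory if it is encoded by a Mealy machine with a finite set $Q$ of memory states, a rational initial distribution on $Q$, a next action function mapping each $(s,q)\in S\times Q$ to a rational distribution on $A$ supported in $A(s)$, and an update function $A\times S\times Q\to Q$ (the memory is updated with the current state and the chosen action); "encoded" means that at every history whose actions the machine chooses with positive probability, $\sigma$ gives the conditional distribution of the machine's next action. Let $\mathbb P^\sigma_{\mathcal M,s}$ be the probability measure on $(SA)^\omega$ induced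 by $\sigma$ from the initial state $s$. Let $\Omega$ be $\mathsf{mp}$, with a weight function $w\colon A\to\mathbb Z$, or $\mathsf{par}$, with a priority function $p\colon S\to\mathbb N$. For a window size $\lambda\in\mathbb N$, $\lambda>0$, let $$\mathsf{GW}_{\mathsf{mp}}(\lambda)=\Big\{\rho \;\Big|\; \exists\, l<\lambda,\ \tfrac1{l+1}\sum_{i=0}^{l}w(a_i)\ge 0\Big\},$$ $$\mathsf{GW}_{\mathsf{par}}(\lambda)=\big\{\rho \mid \exists\, l<\lambda,\ p(s_l)\text{ is even and } p(s_l)<p(s_k)\text{ for all }k<l\big\},$$ $$\mathsf{DFW}_\Omega(\lambda)=\{\rho\mid\forall\, j\ge0,\ \rho[j,\infty]\in\mathsf{GW}_\Omega(\lambda)\},\qquad \mathsf{FW}_\Omega(\lambda)=\{\rho\mid\exists\, i\ge0,\ \rho[i,\infty]\in\mathsf{DFW}_\Omega(\lambda)\},$$ where $\rho=s_0a_0s_1a_1\ldots$ ranges over the runs of $\mathcal M$. **Theorem.** Let $\mathcal M=(S,A,\delta)$ be a Markov decision process, $s\in S$, $\lambda>0$, $\Omega\in\{\mathsf{mp},\mathsf{par}\}$,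 $E\in\{\mathsf{DFW}_\Omega(\lambda),\mathsf{FW}_\Omega(\lambda)\}$ and $\alpha\in[0,1]\cap\mathbb Q$. If there is a strategy $\sigma$ with $\mathbb P^\sigma_{\mathcal M,s}[E]\ge\alpha$, then there is a pure finite-memory strategy $\sigma'$ with $\mathbb P^{\sigma'}_{\mathcal M,s}[E]\ge\alpha$. -/

import Mathlib

open MeasureTheory ProbabilityTheory
open scoped ENNReal

noncomputable section

/-- A distribution is rational if all its point masses are rational numbers. -/
def PMF.IsRational {X : Type*} (p : PMF X) : Prop :=
  ∀ x, ∃ q : ℚ, (p x).toReal = (q : ℝ)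

/-- A Markov decision process with states `S` and actions `A`. The transition function is partial:
`δ s a = none` means that `a` is not available in `s`. Every state has an available action. -/
structure MDP (S A : Type*) where
  δ : S → A → Option (PMF S)
  rational : ∀ s a p, δ s a = some p → p.IsRational
  deadlockFree : ∀ s, ∃ a, (δ s a).isSome

namespace MDP

variable {S A : Type*}

/-- The set `A(s)` of actions available in `s`. -/
def avail (M : MDP S A) (s : S) : Set A := {a | (M.δ s a).isSome}

/-- `δ(s, a, t)`, read as `0` if `a` is not available in `s`. -/
def prob (M : MDP S A) (s : S) (a : A) (t : S) : ℝ≥0∞ := (M.δ s a).elim 0 (fun p => p t)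

/-- `(s, a, t) ∈ δ`: the transition from `s` to `t` under `a` has positive probability. -/
def Edge (M : MDP S A) (s : S) (a : A) (t : S) : Prop := 0 < M.prob s a t

/-- The set of runs. The run `s₀ a₀ s₁ a₁ …` is the sequence of the pairs `(sᵢ, aᵢ)`. -/
def Runs (M : MDP S A) : Set (ℕ → S × A) :=
  {ρ | ∀ i, M.Edge (ρ i).1 (ρ i).2 (ρ (i + 1)).1}

/-- `s₀ a₀ … aₙ₋₁ sₙ` is a history; it is given by the list of the pairs `(sᵢ, aᵢ)` for `i < n`
and by its last state `sₙ`. -/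
def IsHist (M : MDP S A) (l : List (S × A)) (t : S) : Prop :=
  l.IsChain (fun x y => M.Edge x.1 x.2 y.1) ∧ ∀ x ∈ l.getLast?, M.Edge x.1 x.2 t

/-- The histories `s₀ a₀ … aₙ₋₁ sₙ`: lists of pairs `(sᵢ, aᵢ)` together with the last state. -/
def Hist (M : MDP S A) : Type _ := {h : List (S × A) × S // M.IsHist h.1 h.2}

/-- The last state of a history. -/
def Hist.last {M : MDP S A} (h : M.Hist) : S := h.1.2

/-- The history that consists of a single state. -/
def Hist.single (M : MDP S A) (s : S) : M.Hist :=
  ⟨([], s), List.isChain_nil, by simp⟩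

/-- A (history-dependent, randomised) strategy. -/
structure Strategy (M : MDP S A) where
  act : M.Hist → PMF A
  rational : ∀ h, (act h).IsRational
  supp : ∀ h, (act h).support ⊆ M.avail h.last

/-- A strategy is pure if it maps all histories to Dirac distributions. -/
def Strategy.IsPure {M : MDP S A} (σ : M.Strategy) : Prop := ∀ h, ∃ a, σ.act h = PMF.pure a

/-- A Mealy machine with set of memory states `Q`: an initial distribution on memory states, a next
action function, and a memory update function. -/
structure Mealy (M : MDP S A) (Q : Type*) where
  init : PMF Q
  next : S → Q → PMF A
  upd : A → S → Q → Q
  init_rational : init.IsRational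
  next_rational : ∀ s q, (next s q).IsRational
  next_supp : ∀ s q, (next s q).support ⊆ M.avail s

namespace Mealy

variable {M : MDP S A} {Q : Type*}

/-- The memory state reached from `q` after reading `s₀ a₀ … sₙ₋₁ aₙ₋₁`. -/
def memory (N : M.Mealy Q) : Q → List (S × A) → Q
  | q, [] => q
  | q, x :: l => N.memory (N.upd x.2 x.1 q) l

/-- The probability that the machine, started in the memory state `q`, chooses the actions
`a₀, …, aₙ₋₁` when the states visited are `s₀, …, sₙ₋₁`. -/
def weight (N : M.Mealy Q) : Q → List (S × A) → ℝ≥0∞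
  | _, [] => 1
  | q, x :: l => N.next x.1 q x.2 * N.weight (N.upd x.2 x.1 q) l

/-- The machine encodes `σ`: after each history `h`, the distribution `σ(h)` is the conditional
distribution of the next action of the machine, given that the machine has chosen the actions along
`h`. The conditional probability is written with its denominator cleared, so that there is no
constraint on `σ` at the histories whose actions the machine chooses with probability zero. -/
def Encodes (N : M.Mealy Q) (σ : M.Strategy) : Prop :=
  ∀ (h : M.Hist) (a : A),
    (∑' q, N.init q * N.weight q h.1.1) * σ.act h a =
      ∑' q, N.init q * N.weight q h.1.1 * N.next h.last (N.memory q h.1.1) a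

end Mealy

/-- A strategy is finite-memory if a Mealy machine with finitely many memory states encodes it. -/
def Strategy.IsFiniteMemory {M : MDP S A} (σ : M.Strategy) : Prop :=
  ∃ (Q : Type) (_ : Finite Q) (N : M.Mealy Q), N.Encodes σ

open Classical in
/-- The strategy on arbitrary finite sequences. The value at a sequence that is not a history is
irrelevant, since such sequences have probability zero. -/
def Strategy.actExt {M : MDP S A} (σ : M.Strategy) (l : List (S × A)) (t : S) : PMF A :=
  if h : M.IsHist l t then σ.act ⟨(l, t), h⟩ else σ.act (Hist.single M t)

/-- The law of the next pair `(t, b)` after `s₀ a₀ … sₙ aₙ`: the state `t` is drawn from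
`δ(sₙ, aₙ)` and then the action `b` from `σ(s₀ a₀ … sₙ aₙ t)`. The value for an action `aₙ` that is
not available in `sₙ` is irrelevant, since strategies never choose such an action. -/
def Strategy.step {M : MDP S A} (σ : M.Strategy) (n : ℕ) (x : (i : Finset.Iic n) → S × A) :
    PMF (S × A) :=
  let last := x ⟨n, Finset.mem_Iic.2 le_rfl⟩
  let l := List.ofFn (fun i : Fin (n + 1) => x ⟨i, Finset.mem_Iic.2 (Nat.le_of_lt_succ i.2)⟩)
  ((M.δ last.1 last.2).getD (PMF.pure last.1)).bind
    (fun t => (σ.actExt l t).map (fun b => (t, b)))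

section Law

variable [Finite S] [Finite A] [MeasurableSpace S] [MeasurableSpace A]
  [DiscreteMeasurableSpace S] [DiscreteMeasurableSpace A]

/-- `Strategy.step` as a transition kernel. -/
def Strategy.kernel {M : MDP S A} (σ : M.Strategy) (n : ℕ) :
    Kernel ((i : Finset.Iic n) → S × A) (S × A) :=
  Kernel.ofFunOfCountable (fun x => (σ.step n x).toMeasure)

instance {M : MDP S A} (σ : M.Strategy) (n : ℕ) : IsMarkovKernel (σ.kernel n) :=
  ⟨fun x => PMF.toMeasure.isProbabilityMeasure (σ.step n x)⟩

/-- The probability measure on `(SA)^ω` that is induced by the strategy `σ` from the initial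
state `s`. -/
def Strategy.law {M : MDP S A} (σ : M.Strategy) (s : S) : Measure (ℕ → S × A) :=
  Kernel.trajMeasure (X := fun _ => S × A)
    (((σ.act (Hist.single M s)).map (fun a => (s, a))).toMeasure) σ.kernel

end Law

/-- The data of a window objective: a weight function on actions (mean-payoff variant) or a
priority function on states (parity variant). -/
inductive Variant (S A : Type*) where
  | mp (w : A → ℤ)
  | par (p : S → ℕ)

/-- The suffix `ρ[n, ∞]`. -/
def suffix (ρ : ℕ → S × A) (n : ℕ) : ℕ → S × A := fun k => ρ (n + k)

/-- The mean-payoff `MP(ρ[0, n])` of the prefix up to the `n`-th state, for `n > 0`. -/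
def meanPayoff (w : A → ℤ) (ρ : ℕ → S × A) (n : ℕ) : ℚ :=
  (1 / (n : ℚ)) * ∑ i ∈ Finset.range n, (w (ρ i).2 : ℚ)

/-- The good window objective with window size `lam`. -/
def GW (M : MDP S A) : Variant S A → ℕ → Set (ℕ → S × A)
  | .mp w, lam => {ρ | ρ ∈ M.Runs ∧ ∃ l < lam, 0 ≤ meanPayoff w ρ (l + 1)}
  | .par p, lam =>
      {ρ | ρ ∈ M.Runs ∧ ∃ l < lam, p (ρ l).1 % 2 = 0 ∧ ∀ k < l, p (ρ l).1 < p (ρ k).1}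

/-- The direct fixed window objective with window size `lam`. -/
def DFW (M : MDP S A) (Ω : Variant S A) (lam : ℕ) : Set (ℕ → S × A) :=
  {ρ | ρ ∈ M.Runs ∧ ∀ j, suffix ρ j ∈ M.GW Ω lam}

/-- The (prefix-independent) fixed window objective with window size `lam`. -/
def FW (M : MDP S A) (Ω : Variant S A) (lam : ℕ) : Set (ℕ → S × A) :=
  {ρ | ρ ∈ M.Runs ∧ ∃ i, suffix ρ i ∈ M.DFW Ω lam}

end MDP

end

open MeasureTheory ProbabilityTheory Filter Topology
open scoped ENNReal

/-! ### Almost sure properties and one-step integrals of the law of a strategy. -/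

namespace PMF

/-! Whether a window is good depends on `lam` consecutive pairs only, so a finite automaton that
buffers the last `lam` pairs detects bad windows. On runs, which have probability one, `FW` means
that bad buffers occur finitely often; for `DFW`, a flag that is never reset gives the absence of
bad buffers the same co-Büchi form (`mem_FW_iff_coBuchi`, `mem_DFW_iff_coBuchi`).

It remains to find an optimal positional choice on the finite product of the process with the
automaton (`exists_pure_finiteMemory_coBuchi`). Charge a factor γ < 1 for every visit to a bad
state. Value iteration bounds the expected discount of every strategy, and its limit is at most its
own one-step value under some fixed choice of actions (`exists_memoryless`); under that choice the
expected discount stays above the limit at all horizons. Infinitely many bad visits drive the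
discount to 0, so the limit is at most the winning probability of the positional strategy. A run
without bad visits from time m on keeps a discount of at least γ ^ m. As there are finitely many
positional choices, the best one satisfies the resulting inequality for all γ and m at once; let γ →
1, then m → ∞. -/

theorem lintegral_toMeasure {X : Type*} [Countable X] [MeasurableSpace X] [DiscreteMeasurableSpace X]
    (p : PMF X) (f : X → ℝ≥0∞) : ∫⁻ x, f x ∂p.toMeasure = ∑' x, p x * f x := by
  rw [lintegral_countable']
  exact tsum_congr fun x => by
    rw [toMeasure_apply_singleton _ _ (measurableSet_singleton x), mul_comm]

theorem ae_mem_support {X : Type*} [MeasurableSpace X] [DiscreteMeasurableSpace X] (p : PMF X) :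
    ∀ᵐ x ∂p.toMeasure, x ∈ p.support := by
  rw [ae_iff, toMeasure_apply_eq_zero_iff _ (MeasurableSet.of_discrete)]
  exact Set.disjoint_left.2 fun x hx h => h hx

end PMF

namespace MDP

variable {S A : Type*}

/-- The list `ρ₀, …, ρₙ₋₁`. -/
def pref (ρ : ℕ → S × A) (n : ℕ) : List (S × A) := List.ofFn fun i : Fin n => ρ i

theorem pref_succ (ρ : ℕ → S × A) (n : ℕ) : pref ρ (n + 1) = pref ρ n ++ [ρ n] := by
  rw [pref, List.ofFn_succ_last]
  rfl

theorem isHist_pref {M : MDP S A} {ρ : ℕ → S × A} {n : ℕ}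
    (h : ∀ i < n, M.Edge (ρ i).1 (ρ i).2 (ρ (i + 1)).1) : M.IsHist (pref ρ n) (ρ n).1 := by
  induction n with
  | zero => simp [IsHist, pref]
  | succ n ih =>
    have ih := ih fun i hi => h i (by omega)
    rw [pref_succ]
    refine ⟨List.isChain_append.2 ⟨ih.1, by simp, ?_⟩, by simpa using h n (by omega)⟩
    intro x hx y hy
    obtain rfl : ρ n = y := by simpa using hy
    exact ih.2 x hx

theorem tsum_prob_le (M : MDP S A) (s : S) (a : A) : ∑' t, M.prob s a t ≤ 1 := by
  unfold prob
  cases M.δ s a with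
  | none => simp
  | some p => simp [p.tsum_coe]

theorem Strategy.support_actExt {M : MDP S A} (σ : M.Strategy) (l : List (S × A)) (t : S) :
    (σ.actExt l t).support ⊆ M.avail t := by
  unfold actExt
  split_ifs with h
  · exact σ.supp ⟨(l, t), h⟩
  · exact σ.supp (Hist.single M t)

theorem Strategy.step_frestrictLe {M : MDP S A} (σ : M.Strategy) (n : ℕ) (ρ : ℕ → S × A) :
    σ.step n (Preorder.frestrictLe n ρ) =
      ((M.δ (ρ n).1 (ρ n).2).getD (PMF.pure (ρ n).1)).bind
        fun t => (σ.actExt (pref ρ (n + 1)) t).map fun b => (t, b) := rfl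

section Law

variable [Finite S] [Finite A] [MeasurableSpace S] [MeasurableSpace A]
  [DiscreteMeasurableSpace S] [DiscreteMeasurableSpace A] {M : MDP S A}

instance (σ : M.Strategy) (s : S) : IsProbabilityMeasure (σ.law s) := by
  have := PMF.toMeasure.isProbabilityMeasure ((σ.act (Hist.single M s)).map (fun a => (s, a)))
  unfold Strategy.law
  infer_instance

theorem Strategy.map_law_zero (σ : M.Strategy) (s : S) :
    (σ.law s).map (fun ρ => ρ 0) =
      ((σ.act (Hist.single M s)).map (fun a => (s, a))).toMeasure := by
  have h : (fun ρ : ℕ → S × A => ρ 0) =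
      (MeasurableEquiv.piUnique (fun _ : Finset.Iic 0 => S × A)) ∘ Preorder.frestrictLe 0 := rfl
  rw [h, ← Measure.map_map (by fun_prop) (by fun_prop), law, Kernel.trajMeasure,
    Measure.map_comp _ _ (by fun_prop), Kernel.traj_map_frestrictLe, Kernel.partialTraj_self,
    Measure.id_comp, Measure.map_map (by fun_prop) (by fun_prop)]
  exact Measure.map_id

theorem Strategy.ae_zero (σ : M.Strategy) (s : S) :
    ∀ᵐ ρ ∂σ.law s, (ρ 0).1 = s ∧ (ρ 0).2 ∈ (σ.act (Hist.single M s)).support := by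
  have h := PMF.ae_mem_support ((σ.act (Hist.single M s)).map (fun a => (s, a)))
  rw [← σ.map_law_zero s] at h
  filter_upwards [ae_of_ae_map (measurable_pi_apply 0).aemeasurable h] with ρ hρ
  obtain ⟨a, ha, h⟩ := (PMF.mem_support_map_iff _ _ _).1 hρ
  rw [← h]
  exact ⟨rfl, ha⟩

theorem Strategy.map_law_succ (σ : M.Strategy) (s : S) (n : ℕ) :
    (σ.law s).map (fun ρ => (Preorder.frestrictLe n ρ, ρ (n + 1))) =
      ((σ.law s).map (Preorder.frestrictLe n)) ⊗ₘ σ.kernel n := by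
  have := PMF.toMeasure.isProbabilityMeasure ((σ.act (Hist.single M s)).map (fun a => (s, a)))
  exact (Kernel.map_frestrictLe_trajMeasure_compProd_eq_map_trajMeasure (X := fun _ => S × A)).symm

/-- Disintegration over the first `n + 1` pairs. No measurability of `G` is needed, because a finite
product of finite discrete spaces is discrete. -/
theorem Strategy.lintegral_law_succ (σ : M.Strategy) (s : S) (n : ℕ)
    (G : ((i : Finset.Iic n) → S × A) → S × A → ℝ≥0∞) :
    ∫⁻ ρ, G (Preorder.frestrictLe n ρ) (ρ (n + 1)) ∂σ.law s =
      ∫⁻ ρ, ∫⁻ y, G (Preorder.frestrictLe n ρ) y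
        ∂(σ.step n (Preorder.frestrictLe n ρ)).toMeasure ∂σ.law s := by
  have h1 := lintegral_map (μ := σ.law s) (f := fun z => G z.1 z.2)
    (g := fun ρ => (Preorder.frestrictLe n ρ, ρ (n + 1))) .of_discrete (by fun_prop)
  rw [← h1, map_law_succ, Measure.lintegral_compProd .of_discrete,
    lintegral_map .of_discrete (by fun_prop)]
  rfl

theorem Strategy.ae_succ (σ : M.Strategy) (s : S) (n : ℕ) :
    ∀ᵐ ρ : ℕ → S × A ∂σ.law s, ρ (n + 1) ∈ (σ.step n (Preorder.frestrictLe n ρ)).support := by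
  have h := Measure.ae_compProd_of_ae_ae (μ := (σ.law s).map (Preorder.frestrictLe n))
    (κ := σ.kernel n) (p := fun z => z.2 ∈ (σ.step n z.1).support)
    (MeasurableSet.of_discrete (α := ((i : Finset.Iic n) → S × A) × (S × A)))
    (ae_of_all _ fun x => (σ.step n x).ae_mem_support)
  rw [← map_law_succ] at h
  exact ae_of_ae_map (by fun_prop) h

/-- The actions are almost surely available. -/
theorem Strategy.ae_mem_avail (σ : M.Strategy) (s : S) (n : ℕ) :
    ∀ᵐ ρ ∂σ.law s, (ρ n).2 ∈ M.avail (ρ n).1 := by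
  cases n with
  | zero =>
    filter_upwards [σ.ae_zero s] with ρ hρ
    rw [hρ.1]
    exact σ.supp _ hρ.2
  | succ n =>
    filter_upwards [σ.ae_succ s n] with ρ hρ
    rw [step_frestrictLe, PMF.mem_support_bind_iff] at hρ
    obtain ⟨t, -, ht⟩ := hρ
    obtain ⟨b, hb, h⟩ := (PMF.mem_support_map_iff _ _ _).1 ht
    rw [← h]
    exact σ.support_actExt _ _ hb

theorem Strategy.ae_edge_and_act (σ : M.Strategy) (s : S) (n : ℕ) :
    ∀ᵐ ρ ∂σ.law s, M.Edge (ρ n).1 (ρ n).2 (ρ (n + 1)).1 ∧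
      (ρ (n + 1)).2 ∈ (σ.actExt (pref ρ (n + 1)) (ρ (n + 1)).1).support := by
  filter_upwards [σ.ae_succ s n, σ.ae_mem_avail s n] with ρ hρ ha
  rw [step_frestrictLe, PMF.mem_support_bind_iff] at hρ
  obtain ⟨t, ht, hb⟩ := hρ
  obtain ⟨b, hb, h⟩ := (PMF.mem_support_map_iff _ _ _).1 hb
  rw [← h]
  refine ⟨?_, hb⟩
  -- Availability excludes the default Dirac distribution in `step`, which need not yield an edge.
  obtain ⟨p, hp⟩ := Option.isSome_iff_exists.1 ha
  rw [hp, Option.getD_some, PMF.mem_support_iff] at ht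
  simpa [Edge, prob, hp, pos_iff_ne_zero] using ht

theorem Strategy.ae_mem_runs (σ : M.Strategy) (s : S) : ∀ᵐ ρ ∂σ.law s, ρ ∈ M.Runs :=
  ae_all_iff.2 fun n => (σ.ae_edge_and_act s n).mono fun _ h => h.1

/-- Almost surely, the strategy chooses all actions with positive probability. -/
theorem Strategy.ae_mem_support_act (σ : M.Strategy) (s : S) :
    ∀ᵐ ρ ∂σ.law s, ∀ n, ∃ h : M.IsHist (pref ρ n) (ρ n).1,
      (ρ n).2 ∈ (σ.act ⟨(pref ρ n, (ρ n).1), h⟩).support := by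
  filter_upwards [σ.ae_mem_runs s, σ.ae_zero s, ae_all_iff.2 (σ.ae_edge_and_act s)]
    with ρ hρ h0 h n
  have hn : M.IsHist (pref ρ n) (ρ n).1 := isHist_pref fun i _ => hρ i
  refine ⟨hn, ?_⟩
  cases n with
  | zero =>
    have : (⟨(pref ρ 0, (ρ 0).1), hn⟩ : M.Hist) = Hist.single M s := by
      apply Subtype.ext
      simp [Hist.single, pref, h0.1]
    rw [this]
    exact h0.2
  | succ n =>
    have := (h n).2
    rwa [actExt, dif_pos hn] at this

/-- The one-step formula for functions of the first `n + 1` pairs and the next state. -/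
theorem Strategy.lintegral_next_state (σ : M.Strategy) (s : S) (n : ℕ)
    (G : (ℕ → S × A) → S → ℝ≥0∞) (hG : ∀ t, DependsOn (fun ρ => G ρ t) (Set.Iic n)) :
    ∫⁻ ρ, G ρ (ρ (n + 1)).1 ∂σ.law s =
      ∫⁻ ρ, ∑' t, M.prob (ρ n).1 (ρ n).2 t * G ρ t ∂σ.law s := by
  -- Freezing the segment after its last entry makes it a full sequence, so `G` factors through the
  -- segment.
  let ext (x : (i : Finset.Iic n) → S × A) (i : ℕ) : S × A :=
    x ⟨min i n, Finset.mem_Iic.2 (min_le_right _ _)⟩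
  have hext (ρ : ℕ → S × A) (t : S) : G (ext (Preorder.frestrictLe n ρ)) t = G ρ t := by
    refine hG t fun i hi => ?_
    simp [ext, Preorder.frestrictLe_apply, min_eq_left (Set.mem_Iic.1 hi)]
  have h := σ.lintegral_law_succ s n fun x y => G (ext x) y.1
  simp only [hext] at h
  rw [h]
  refine lintegral_congr_ae ?_
  filter_upwards [σ.ae_mem_avail s n] with ρ ha
  obtain ⟨p, hp⟩ := Option.isSome_iff_exists.1 ha
  -- Forgetting the next action removes the strategy from the step and leaves the transition
  -- distribution.
  have hmap : ((σ.step n (Preorder.frestrictLe n ρ)).map Prod.fst) = p := by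
    rw [step_frestrictLe, hp, PMF.map_bind]
    simp only [Option.getD_some, PMF.map_comp, Function.comp_def]
    exact (congrArg p.bind (funext fun t => PMF.map_const _ t)).trans p.bind_pure
  rw [← lintegral_map (f := G ρ) .of_discrete measurable_fst, PMF.toMeasure_map (f := Prod.fst) _ measurable_fst,
    hmap, PMF.lintegral_toMeasure]
  simp [prob, hp]

end Law

end MDP

/-! ### Discounted value iteration on the product with an automaton. -/

namespace MDP

variable {S A Q : Type*}

/-- The states of a deterministic automaton with initial state `q₀` and update function `u` that
reads the pairs `(sᵢ, aᵢ)` of `ρ`. -/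
def track (u : Q → S × A → Q) (q₀ : Q) (ρ : ℕ → S × A) : ℕ → Q
  | 0 => q₀
  | n + 1 => u (track u q₀ ρ n) (ρ n)

theorem track_congr (u : Q → S × A → Q) (q₀ : Q) {ρ ρ' : ℕ → S × A} {n : ℕ}
    (h : ∀ i < n, ρ i = ρ' i) : track u q₀ ρ n = track u q₀ ρ' n := by
  induction n with
  | zero => rfl
  | succ n ih => simp only [track, ih fun i hi => h i (by omega), h n (by omega)]

theorem foldl_pref (u : Q → S × A → Q) (q₀ : Q) (ρ : ℕ → S × A) (n : ℕ) :
    (pref ρ n).foldl u q₀ = track u q₀ ρ n := by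
  induction n with
  | zero => simp [pref, track]
  | succ n ih => simp [pref_succ, track, ih]

/-- The expected value of `f` after playing `a` in `x`, discounted by the factor that `c` gives to
the automaton state that is reached. -/
noncomputable def oneStep (M : MDP S A) (u : Q → S × A → Q) (c : Q → ℝ≥0∞) (f : S × Q → ℝ≥0∞)
    (x : S × Q) (a : A) : ℝ≥0∞ :=
  c (u x.2 (x.1, a)) * ∑' t, M.prob x.1 a t * f (t, u x.2 (x.1, a))

/-- The optimal expected discount that is collected in `n` steps. -/
noncomputable def value (M : MDP S A) (u : Q → S × A → Q) (c : Q → ℝ≥0∞) : ℕ → S × Q → ℝ≥0∞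
  | 0 => fun _ => 1
  | n + 1 => fun x => ⨆ a ∈ M.avail x.1, M.oneStep u c (M.value u c n) x a

/-- The discount that is collected in the first `n` steps of `ρ`. -/
noncomputable def discount (u : Q → S × A → Q) (q₀ : Q) (c : Q → ℝ≥0∞) (n : ℕ) (ρ : ℕ → S × A) :
    ℝ≥0∞ :=
  ∏ k ∈ Finset.range n, c (track u q₀ ρ (k + 1))

theorem oneStep_mono (M : MDP S A) (u : Q → S × A → Q) (c : Q → ℝ≥0∞) {f g : S × Q → ℝ≥0∞}
    (h : f ≤ g) (x : S × Q) (a : A) : M.oneStep u c f x a ≤ M.oneStep u c g x a := by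
  unfold oneStep
  gcongr
  exact h _

theorem value_antitone (M : MDP S A) (u : Q → S × A → Q) {c : Q → ℝ≥0∞} (hc : c ≤ 1) :
    Antitone (M.value u c) := by
  refine antitone_nat_of_succ_le fun n => ?_
  induction n with
  | zero =>
    refine fun x => iSup₂_le fun a _ => ?_
    calc M.oneStep u c (M.value u c 0) x a
        = c (u x.2 (x.1, a)) * ∑' t, M.prob x.1 a t := by simp [oneStep, value]
      _ ≤ 1 * 1 := mul_le_mul' (hc _) (M.tsum_prob_le _ _)
      _ = 1 := one_mul 1
  | succ n ih => exact fun x => iSup₂_mono fun a _ => M.oneStep_mono u c ih x a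

theorem prob_ne_top (M : MDP S A) (s : S) (a : A) (t : S) : M.prob s a t ≠ ⊤ :=
  ne_top_of_le_ne_top ENNReal.one_ne_top ((ENNReal.le_tsum t).trans (M.tsum_prob_le s a))

/-- The limit of value iteration is witnessed by a choice of one action for each state. -/
theorem exists_memoryless (M : MDP S A) [Finite S] [Finite A] (u : Q → S × A → Q) {c : Q → ℝ≥0∞}
    (hc : c ≤ 1) :
    ∃ d : S × Q → A, ∀ x, d x ∈ M.avail x.1 ∧
      ⨅ n, M.value u c n x ≤ M.oneStep u c (fun y => ⨅ n, M.value u c n y) x (d x) := by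
  suffices h : ∀ x : S × Q, ∃ a, a ∈ M.avail x.1 ∧
      ⨅ n, M.value u c n x ≤ M.oneStep u c (fun y => ⨅ n, M.value u c n y) x a by
    choose d hd using h
    exact ⟨d, hd⟩
  intro x
  have hmax (n : ℕ) : ∃ a ∈ M.avail x.1,
      M.value u c (n + 1) x = M.oneStep u c (M.value u c n) x a := by
    obtain ⟨a, ha, h⟩ := Set.exists_max_image (M.avail x.1)
      (M.oneStep u c (M.value u c n) x) (Set.toFinite _) (M.deadlockFree x.1)
    exact ⟨a, ha, le_antisymm (iSup₂_le h) (le_iSup₂_of_le a ha le_rfl)⟩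
  choose b hb hval using hmax
  -- By pigeonhole, one action is optimal for infinitely many horizons.
  obtain ⟨a, ha⟩ := Finite.exists_infinite_fiber b
  have hfreq (n : ℕ) : ∃ m > n, b m = a := by
    obtain ⟨m, hm, hn⟩ := (Set.infinite_coe_iff.1 ha).exists_gt n
    exact ⟨m, hn, hm⟩
  obtain ⟨m₀, -, hm₀⟩ := hfreq 0
  refine ⟨a, hm₀ ▸ hb m₀, ?_⟩
  have hlim : Tendsto (fun n => M.oneStep u c (M.value u c n) x a) atTop
      (𝓝 (M.oneStep u c (fun y => ⨅ n, M.value u c n y) x a)) := by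
    have := Fintype.ofFinite S
    unfold oneStep
    simp only [tsum_fintype]
    refine ENNReal.Tendsto.const_mul (tendsto_finsetSum _ fun t _ => ?_)
      (Or.inr (ne_top_of_le_ne_top ENNReal.one_ne_top (hc _)))
    refine ENNReal.Tendsto.const_mul (tendsto_atTop_iInf fun m n h => ?_)
      (Or.inr (M.prob_ne_top _ _ _))
    exact M.value_antitone u hc h _
  -- For each `n`, pass to a later horizon `m` at which `a` is optimal; antitonicity then brings the
  -- bound back to `n`.
  refine ge_of_tendsto' hlim fun n => ?_
  obtain ⟨m, hm, rfl⟩ := hfreq n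
  calc ⨅ n, M.value u c n x ≤ M.value u c (m + 1) x := iInf_le _ _
    _ = M.oneStep u c (M.value u c m) x (b m) := hval m
    _ ≤ M.oneStep u c (M.value u c n) x (b m) :=
      M.oneStep_mono u c (M.value_antitone u hc hm.le) _ _

theorem discount_antitone (u : Q → S × A → Q) (q₀ : Q) {c : Q → ℝ≥0∞} (hc : c ≤ 1) :
    Antitone (discount u q₀ c) :=
  antitone_nat_of_succ_le fun n ρ => by
    simpa [discount, Finset.prod_range_succ] using mul_le_of_le_one_right' (hc _)

theorem discount_congr (u : Q → S × A → Q) (q₀ : Q) (c : Q → ℝ≥0∞) {ρ ρ' : ℕ → S × A} {n : ℕ}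
    (h : ∀ i < n, ρ i = ρ' i) : discount u q₀ c n ρ = discount u q₀ c n ρ' :=
  Finset.prod_congr rfl fun k hk => by
    rw [track_congr u q₀ fun i hi => h i (by have := Finset.mem_range.1 hk; omega)]

theorem pow_le_discount (u : Q → S × A → Q) (q₀ : Q) {c : Q → ℝ≥0∞} {γ : ℝ≥0∞} (hγ : γ ≤ 1)
    (hcγ : ∀ q, γ ≤ c q) {ρ : ℕ → S × A} {m : ℕ} (h : ∀ n ≥ m, c (track u q₀ ρ n) = 1) (n : ℕ) :
    γ ^ m ≤ discount u q₀ c n ρ := by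
  -- The exponent `min m n` makes the induction work: a factor below 1 costs one power, and only
  -- before time `m`.
  have hn (n : ℕ) : γ ^ min m n ≤ discount u q₀ c n ρ := by
    induction n with
    | zero => simp [discount]
    | succ n ih =>
      rw [discount, Finset.prod_range_succ]
      by_cases hm : m ≤ n + 1
      · rw [h (n + 1) hm, mul_one]
        exact (pow_le_pow_right_of_le_one' hγ (by omega)).trans ih
      · rw [min_eq_right (by omega), pow_succ]
        rw [min_eq_right (by omega)] at ih
        exact mul_le_mul' ih (hcγ _)
  exact (pow_le_pow_right_of_le_one' hγ (min_le_left _ _)).trans (hn n)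

/-- The runs that visit bad automaton states only finitely often. -/
def coBuchi (u : Q → S × A → Q) (q₀ : Q) (Bad : Set Q) : Set (ℕ → S × A) :=
  {ρ | ∃ m, ∀ n ≥ m, track u q₀ ρ n ∉ Bad}

theorem iInf_discount_eq_zero (u : Q → S × A → Q) (q₀ : Q) {c : Q → ℝ≥0∞} (hc : c ≤ 1)
    {Bad : Set Q} {γ : ℝ≥0∞} (hγ : γ < 1) (hbad : ∀ q ∈ Bad, c q = γ) {ρ : ℕ → S × A}
    (h : ρ ∉ coBuchi u q₀ Bad) : ⨅ n, discount u q₀ c n ρ = 0 := by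
  have hpow (k : ℕ) : ∃ n, discount u q₀ c n ρ ≤ γ ^ k := by
    induction k with
    | zero => exact ⟨0, by simp [discount]⟩
    | succ k ih =>
      obtain ⟨n, hn⟩ := ih
      simp only [coBuchi, Set.mem_ofPred_eq, not_exists, not_forall, not_not] at h
      -- Asking for a bad visit after time `n` ensures that its factor is not yet counted in
      -- `discount u q₀ c n ρ`.
      obtain ⟨m, hm, hb⟩ := h (n + 1)
      obtain ⟨m, rfl⟩ : ∃ i, m = i + 1 := ⟨m - 1, by omega⟩
      refine ⟨m + 1, ?_⟩
      rw [discount, Finset.prod_range_succ, hbad _ hb, pow_succ]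
      gcongr
      exact (discount_antitone u q₀ hc (by omega) ρ).trans hn
  refine le_antisymm (ge_of_tendsto' (ENNReal.tendsto_pow_atTop_nhds_zero_of_lt_one hγ) fun k => ?_)
    zero_le
  obtain ⟨n, hn⟩ := hpow k
  exact iInf_le_of_le n hn

end MDP

/-! ### Optimality of positional strategies for co-Büchi objectives. -/

theorem PMF.isRational_pure {X : Type*} (x : X) : (PMF.pure x).IsRational := by
  intro y
  by_cases h : y = x
  · exact ⟨1, by simp [h]⟩
  · exact ⟨0, by simp [h]⟩

namespace MDP

variable {S A Q : Type*}

/-- The strategy that plays according to `d`, a choice of one action for each pair of a state and a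
state of an automaton that reads the history. -/
noncomputable def memoryless (M : MDP S A) (u : Q → S × A → Q) (q₀ : Q) (d : S × Q → A)
    (hd : ∀ x, d x ∈ M.avail x.1) : M.Strategy where
  act h := PMF.pure (d (h.last, h.1.1.foldl u q₀))
  rational _ := PMF.isRational_pure _
  supp h := by simpa using hd (h.last, h.1.1.foldl u q₀)

theorem memoryless_isPure (M : MDP S A) (u : Q → S × A → Q) (q₀ : Q) (d : S × Q → A)
    (hd : ∀ x, d x ∈ M.avail x.1) : (M.memoryless u q₀ d hd).IsPure :=
  fun _ => ⟨_, rfl⟩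

/-- The automaton itself serves as the memory. With a Dirac initial distribution both sums collapse
to one term, and both sides carry the same weight, which never has to be computed. -/
theorem memoryless_isFiniteMemory [Finite Q] (M : MDP S A) (u : Q → S × A → Q) (q₀ : Q)
    (d : S × Q → A) (hd : ∀ x, d x ∈ M.avail x.1) :
    (M.memoryless u q₀ d hd).IsFiniteMemory := by
  -- Memory sets must live in `Type`, whereas `Q` may be in any universe.
  let e := Finite.equivFin Q
  let N : M.Mealy (Fin (Nat.card Q)) :=
    { init := PMF.pure (e q₀)
      next := fun s i => PMF.pure (d (s, e.symm i))
      upd := fun a s i => e (u (e.symm i) (s, a))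
      init_rational := PMF.isRational_pure _
      next_rational := fun _ _ => PMF.isRational_pure _
      next_supp := fun s i => by simpa using hd (s, e.symm i) }
  have hmem (l : List (S × A)) : ∀ q, N.memory (e q) l = e (l.foldl u q) := by
    induction l with
    | nil => exact fun _ => rfl
    | cons x l ih =>
      intro q
      have : N.upd x.2 x.1 (e q) = e (u q x) := by simp [N]
      rw [Mealy.memory, this, ih, List.foldl_cons]
  refine ⟨Fin (Nat.card Q), inferInstance, N, fun h a => ?_⟩
  have hinit (i : Fin (Nat.card Q)) (hi : i ≠ e q₀) : N.init i = 0 := by simp [N, hi]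
  rw [tsum_eq_single (e q₀) fun i hi => by simp [hinit i hi],
    tsum_eq_single (e q₀) fun i hi => by simp [hinit i hi], hmem]
  simp [N, memoryless]

theorem coBuchi_eq_iUnion (u : Q → S × A → Q) (q₀ : Q) (Bad : Set Q) :
    coBuchi u q₀ Bad = ⋃ m, {ρ : ℕ → S × A | ∀ n ≥ m, track u q₀ ρ n ∉ Bad} :=
  Set.ofPred_exists _

section Law

variable [Finite S] [Finite A] [MeasurableSpace S] [MeasurableSpace A]
  [DiscreteMeasurableSpace S] [DiscreteMeasurableSpace A] {M : MDP S A}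

theorem ae_memoryless_act (u : Q → S × A → Q) (q₀ : Q) (d : S × Q → A)
    (hd : ∀ x, d x ∈ M.avail x.1) (s : S) :
    ∀ᵐ ρ ∂(M.memoryless u q₀ d hd).law s, ∀ n, (ρ n).2 = d ((ρ n).1, track u q₀ ρ n) := by
  filter_upwards [(M.memoryless u q₀ d hd).ae_mem_support_act s] with ρ hρ n
  obtain ⟨h, hn⟩ := hρ n
  simpa [memoryless, Hist.last, foldl_pref] using hn

theorem measurable_of_dependsOn {X : Type*} [MeasurableSpace X] (n : ℕ) (g : (ℕ → S × A) → X)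
    (hg : DependsOn g (Set.Iic n)) : Measurable g := by
  let ext (x : (i : Finset.Iic n) → S × A) (i : ℕ) : S × A :=
    x ⟨min i n, Finset.mem_Iic.2 (min_le_right _ _)⟩
  have : g = (fun x => g (ext x)) ∘ Preorder.frestrictLe n := by
    funext ρ
    refine hg fun i hi => ?_
    simp [ext, Preorder.frestrictLe_apply, min_eq_left (Set.mem_Iic.1 hi)]
  rw [this]
  exact Measurable.of_discrete.comp (by fun_prop)

theorem measurable_discount (u : Q → S × A → Q) (q₀ : Q) (c : Q → ℝ≥0∞) (n : ℕ) :
    Measurable (discount (S := S) (A := A) u q₀ c n) :=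
  measurable_of_dependsOn n _ fun _ _ h => discount_congr u q₀ c fun i hi => h i hi.le

theorem measurableSet_track_notMem (u : Q → S × A → Q) (q₀ : Q) (Bad : Set Q) (m : ℕ) :
    MeasurableSet {ρ : ℕ → S × A | ∀ n ≥ m, track u q₀ ρ n ∉ Bad} := by
  have (n : ℕ) : Measurable fun ρ : ℕ → S × A => track u q₀ ρ n ∉ Bad :=
    measurable_of_dependsOn n _ fun ρ ρ' h => by
      simp only [track_congr u q₀ fun i hi => h i (le_of_lt hi)]
  simp only [Set.ofPred_forall]
  exact MeasurableSet.iInter fun n => MeasurableSet.iInter fun _ => (this n).setOf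

theorem measurableSet_coBuchi (u : Q → S × A → Q) (q₀ : Q) (Bad : Set Q) :
    MeasurableSet (coBuchi (S := S) (A := A) u q₀ Bad) := by
  rw [coBuchi_eq_iUnion]
  exact MeasurableSet.iUnion fun m => measurableSet_track_notMem u q₀ Bad m

/-- The identity behind both bounds: applied to value iterates it bounds every strategy from above,
applied to their limit it bounds the positional strategy from below. -/
theorem Strategy.lintegral_discount_succ (σ : M.Strategy) (s : S) (u : Q → S × A → Q) (q₀ : Q)
    (c : Q → ℝ≥0∞) (f : S × Q → ℝ≥0∞) (n : ℕ) :
    ∫⁻ ρ, discount u q₀ c (n + 1) ρ * f ((ρ (n + 1)).1, track u q₀ ρ (n + 1)) ∂σ.law s =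
      ∫⁻ ρ, discount u q₀ c n ρ * M.oneStep u c f ((ρ n).1, track u q₀ ρ n) (ρ n).2 ∂σ.law s := by
  rw [σ.lintegral_next_state s n
    fun ρ t => discount u q₀ c (n + 1) ρ * f (t, track u q₀ ρ (n + 1))]
  · refine lintegral_congr fun ρ => ?_
    simp only [discount, Finset.prod_range_succ, oneStep, track, ← ENNReal.tsum_mul_left]
    exact tsum_congr fun t => by ring
  · intro t ρ ρ' h
    have h' : ∀ i < n + 1, ρ i = ρ' i := fun i hi => h i (Nat.lt_succ_iff.1 hi)
    simp only [discount_congr u q₀ c h', track_congr u q₀ h']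

theorem Strategy.lintegral_zero_state (σ : M.Strategy) (s : S) (u : Q → S × A → Q) (q₀ : Q)
    (c : Q → ℝ≥0∞) (f : S × Q → ℝ≥0∞) :
    ∫⁻ ρ, discount u q₀ c 0 ρ * f ((ρ 0).1, track u q₀ ρ 0) ∂σ.law s = f (s, q₀) := by
  rw [lintegral_congr_ae (g := fun _ => f (s, q₀))]
  · simp
  · filter_upwards [σ.ae_zero s] with ρ hρ
    simp [discount, track, hρ.1]

/-- No strategy does better than value iteration. -/
theorem Strategy.lintegral_discount_le (σ : M.Strategy) (s : S) (u : Q → S × A → Q) (q₀ : Q)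
    (c : Q → ℝ≥0∞) (n : ℕ) :
    ∫⁻ ρ, discount u q₀ c n ρ ∂σ.law s ≤ M.value u c n (s, q₀) := by
  -- The remaining horizon `k` is kept general, since each induction step moves one unit from `n` to
  -- `k`.
  have h (n : ℕ) : ∀ k, ∫⁻ ρ, discount u q₀ c n ρ *
      M.value u c k ((ρ n).1, track u q₀ ρ n) ∂σ.law s ≤ M.value u c (n + k) (s, q₀) := by
    induction n with
    | zero => exact fun k => by rw [σ.lintegral_zero_state, zero_add]
    | succ n ih =>
      intro k
      rw [σ.lintegral_discount_succ, add_right_comm]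
      refine le_trans (lintegral_mono_ae ?_) (ih (k + 1))
      filter_upwards [σ.ae_mem_avail s n] with ρ ha
      gcongr
      exact le_iSup₂_of_le (ρ n).2 ha le_rfl
  simpa [value] using h n 0

/-- By `hw`, the expectation of the discount times `w` does not decrease under `d`; `hw1` then
allows `w` to be dropped. -/
theorem le_lintegral_discount_memoryless (u : Q → S × A → Q) (q₀ : Q) (d : S × Q → A)
    (hd : ∀ x, d x ∈ M.avail x.1) (s : S) (c : Q → ℝ≥0∞) (w : S × Q → ℝ≥0∞) (hw1 : w ≤ 1)
    (hw : ∀ x, w x ≤ M.oneStep u c w x (d x)) (n : ℕ) :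
    w (s, q₀) ≤ ∫⁻ ρ, discount u q₀ c n ρ ∂(M.memoryless u q₀ d hd).law s := by
  have h : w (s, q₀) ≤ ∫⁻ ρ, discount u q₀ c n ρ * w ((ρ n).1, track u q₀ ρ n)
      ∂(M.memoryless u q₀ d hd).law s := by
    induction n with
    | zero => rw [Strategy.lintegral_zero_state]
    | succ n ih =>
      rw [Strategy.lintegral_discount_succ]
      refine ih.trans (lintegral_mono_ae ?_)
      filter_upwards [ae_memoryless_act u q₀ d hd s] with ρ hρ
      rw [hρ n]
      gcongr
      exact hw _
  exact h.trans (lintegral_mono fun ρ => mul_le_of_le_one_right' (hw1 _))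

open Classical in
/-- For each discount factor, some memoryless strategy wins the co-Büchi objective with at least the
optimal expected discount. -/
theorem exists_memoryless_discount (u : Q → S × A → Q) (q₀ : Q) (Bad : Set Q) (s : S) {γ : ℝ≥0∞}
    (hγ : γ < 1) :
    ∃ (d : S × Q → A) (hd : ∀ x, d x ∈ M.avail x.1), ∀ (σ : M.Strategy) (m : ℕ),
      γ ^ m * σ.law s {ρ | ∀ n ≥ m, track u q₀ ρ n ∉ Bad} ≤
        (M.memoryless u q₀ d hd).law s (coBuchi u q₀ Bad) := by
  let c : Q → ℝ≥0∞ := fun q => if q ∈ Bad then γ else 1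
  have hc : c ≤ 1 := fun q => by
    by_cases h : q ∈ Bad
    · simpa [c, h] using hγ.le
    · simp [c, h]
  have hcγ (q : Q) : γ ≤ c q := by
    by_cases h : q ∈ Bad
    · simp [c, h]
    · simpa [c, h] using hγ.le
  obtain ⟨d, hd⟩ := M.exists_memoryless u hc
  refine ⟨d, fun x => (hd x).1, fun σ m => ?_⟩
  have hlow : γ ^ m * σ.law s {ρ | ∀ n ≥ m, track u q₀ ρ n ∉ Bad} ≤
      ⨅ n, M.value u c n (s, q₀) := by
    refine le_iInf fun n => le_trans ?_ (σ.lintegral_discount_le s u q₀ c n)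
    rw [← lintegral_indicator_const (measurableSet_track_notMem u q₀ Bad m)]
    refine lintegral_mono fun ρ => Set.indicator_le (fun ρ hρ => ?_) ρ
    exact pow_le_discount u q₀ hγ.le hcγ (fun k hk => if_neg (hρ k hk)) n
  refine hlow.trans ?_
  have hup := le_iInf (le_lintegral_discount_memoryless u q₀ d (fun x => (hd x).1) s c
    (fun y => ⨅ n, M.value u c n y) (fun y => iInf_le_of_le 0 le_rfl) fun x => (hd x).2)
  refine hup.trans ?_
  -- Monotone convergence for the decreasing discounts, whose first term is 1, moves the infimum
  -- inside the integral; off the co-Büchi set that infimum vanishes.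
  rw [← lintegral_iInf (measurable_discount u q₀ c) (discount_antitone u q₀ hc)
    (by simp [discount]), ← lintegral_indicator_one (measurableSet_coBuchi u q₀ Bad)]
  refine lintegral_mono fun ρ => ?_
  by_cases hρ : ρ ∈ coBuchi u q₀ Bad
  · rw [Set.indicator_of_mem hρ]
    exact iInf_le_of_le 0 (by simp [discount])
  · rw [Set.indicator_of_notMem hρ]
    exact (iInf_discount_eq_zero u q₀ hc hγ (fun q hq => if_pos hq) hρ).le

/-- For co-Büchi objectives given by a finite automaton, there is an optimal strategy that is pure
and has finite memory. -/
theorem exists_pure_finiteMemory_coBuchi [Finite Q] (u : Q → S × A → Q) (q₀ : Q) (Bad : Set Q)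
    (s : S) (σ : M.Strategy) :
    ∃ σ' : M.Strategy, σ'.IsPure ∧ σ'.IsFiniteMemory ∧
      σ.law s (coBuchi u q₀ Bad) ≤ σ'.law s (coBuchi u q₀ Bad) := by
  let D := {d : S × Q → A // ∀ x, d x ∈ M.avail x.1}
  let val (d : D) : ℝ≥0∞ := (M.memoryless u q₀ d.1 d.2).law s (coBuchi u q₀ Bad)
  have : Nonempty D := by
    obtain ⟨d, hd, -⟩ := exists_memoryless_discount (M := M) u q₀ Bad s zero_lt_one
    exact ⟨⟨d, hd⟩⟩
  -- This maximiser is fixed before γ and `m`, so its value dominates the strategies obtained for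
  -- every γ.
  obtain ⟨d, hmax⟩ := Finite.exists_max val
  refine ⟨M.memoryless u q₀ d.1 d.2, memoryless_isPure _ _ _ _ _, memoryless_isFiniteMemory _ _ _ _ _, ?_⟩
  change _ ≤ val d
  have hmono : Monotone fun m => {ρ : ℕ → S × A | ∀ n ≥ m, track u q₀ ρ n ∉ Bad} :=
    fun m m' h ρ hρ n hn => hρ n (h.trans hn)
  rw [coBuchi_eq_iUnion, hmono.measure_iUnion]
  refine iSup_le fun m => ?_
  -- The discount factors 1 - 1/(k+1) are below 1 and tend to 1.
  have hlim : Tendsto (fun k : ℕ => (1 - (k + 1 : ℝ≥0∞)⁻¹) ^ m *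
      σ.law s {ρ | ∀ n ≥ m, track u q₀ ρ n ∉ Bad}) atTop
      (𝓝 ((1 - 0) ^ m * σ.law s {ρ | ∀ n ≥ m, track u q₀ ρ n ∉ Bad})) := by
    refine ENNReal.Tendsto.mul_const (ENNReal.Tendsto.pow ?_) (Or.inr (measure_ne_top _ _))
    refine ENNReal.Tendsto.sub tendsto_const_nhds ?_ (Or.inl ENNReal.one_ne_top)
    simpa using (tendsto_add_atTop_iff_nat 1).2 ENNReal.tendsto_inv_nat_nhds_zero
  rw [tsub_zero, one_pow, one_mul] at hlim
  refine le_of_tendsto' hlim fun k => ?_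
  obtain ⟨d', hd', h⟩ := exists_memoryless_discount (M := M) u q₀ Bad s
    (γ := 1 - (k + 1 : ℝ≥0∞)⁻¹)
    (ENNReal.sub_lt_self ENNReal.one_ne_top one_ne_zero (by simp))
  exact (h σ m).trans (hmax ⟨d', hd'⟩)

end Law

end MDP

/-! ### Window objectives as co-Büchi objectives of finite automata. -/

namespace MDP

variable {S A Q : Type*}

theorem suffix_mem_runs {M : MDP S A} {ρ : ℕ → S × A} (h : ρ ∈ M.Runs) (n : ℕ) :
    suffix ρ n ∈ M.Runs :=
  fun i => h (n + i)

/-- A good window starts at the first position of `ρ`. -/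
def GoodWindow : Variant S A → ℕ → (ℕ → S × A) → Prop
  | .mp w, lam, ρ => ∃ l < lam, 0 ≤ meanPayoff w ρ (l + 1)
  | .par p, lam, ρ => ∃ l < lam, p (ρ l).1 % 2 = 0 ∧ ∀ k < l, p (ρ l).1 < p (ρ k).1

theorem mem_GW_iff {M : MDP S A} {Ω : Variant S A} {lam : ℕ} {ρ : ℕ → S × A} :
    ρ ∈ M.GW Ω lam ↔ ρ ∈ M.Runs ∧ GoodWindow Ω lam ρ := by
  cases Ω <;> rfl

theorem mem_DFW_iff {M : MDP S A} {Ω : Variant S A} {lam : ℕ} {ρ : ℕ → S × A} :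
    ρ ∈ M.DFW Ω lam ↔ ρ ∈ M.Runs ∧ ∀ j, GoodWindow Ω lam (suffix ρ j) :=
  and_congr_right fun h => forall_congr' fun j => by simp [mem_GW_iff, suffix_mem_runs h]

theorem suffix_suffix (ρ : ℕ → S × A) (i j : ℕ) : suffix (suffix ρ i) j = suffix ρ (i + j) := by
  funext k
  simp [suffix, add_assoc]

theorem mem_FW_iff {M : MDP S A} {Ω : Variant S A} {lam : ℕ} {ρ : ℕ → S × A} :
    ρ ∈ M.FW Ω lam ↔ ρ ∈ M.Runs ∧ ∃ i, ∀ j ≥ i, GoodWindow Ω lam (suffix ρ j) := by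
  refine and_congr_right fun h => exists_congr fun i => ?_
  simp only [mem_DFW_iff, suffix_mem_runs h, true_and, suffix_suffix]
  refine ⟨fun H j hj => ?_, fun H j => H _ (Nat.le_add_right i j)⟩
  obtain ⟨k, rfl⟩ := Nat.exists_eq_add_of_le hj
  exact H k

theorem GoodWindow.congr {Ω : Variant S A} {lam : ℕ} {ρ ρ' : ℕ → S × A}
    (h : ∀ i < lam, ρ i = ρ' i) (hρ : GoodWindow Ω lam ρ) : GoodWindow Ω lam ρ' := by
  cases Ω with
  | mp w =>
    obtain ⟨l, hl, hρ⟩ := hρ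
    refine ⟨l, hl, hρ.trans_eq ?_⟩
    unfold meanPayoff
    congr 1
    exact Finset.sum_congr rfl fun i hi => by
      rw [h i (by have := Finset.mem_range.1 hi; omega)]
  | par p =>
    obtain ⟨l, hl, he, hρ⟩ := hρ
    refine ⟨l, hl, h l hl ▸ he, fun k hk => ?_⟩
    rw [← h l hl, ← h k (hk.trans hl)]
    exact hρ k hk

/-- The update function of the automaton that stores the last `lam` pairs. -/
def shiftWindow (lam : ℕ) (v : Fin lam → Option (S × A)) (x : S × A) : Fin lam → Option (S × A) :=
  fun i => if h : i + 1 < lam then v ⟨i + 1, h⟩ else some x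

theorem track_shiftWindow {lam : ℕ} (ρ : ℕ → S × A) (n : ℕ) (i : Fin lam) :
    track (shiftWindow lam) (fun _ => none) ρ n i =
      if lam ≤ n + i then some (ρ (n + i - lam)) else none := by
  induction n generalizing i with
  | zero => simp [track]
  | succ n ih =>
    rw [track, shiftWindow]
    by_cases h : (i : ℕ) + 1 < lam
    · rw [dif_pos h, ih]
      simp only [show n + 1 + (i : ℕ) = n + (i + 1) by ring]
    · have hi : (i : ℕ) + 1 = lam := by omega
      rw [dif_neg h, if_pos (by omega), show n + 1 + (i : ℕ) - lam = n by omega]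

/-- The complete windows that are not good. -/
def badWindows (Ω : Variant S A) (lam : ℕ) : Set (Fin lam → Option (S × A)) :=
  {v | ∃ ρ : ℕ → S × A, (∀ i, v i = some (ρ i)) ∧ ¬ GoodWindow Ω lam ρ}

/-- The verdict is delayed: the window that starts at `j` is complete, and judged, at time `j +
lam`. Incomplete buffers are never bad. -/
theorem track_mem_badWindows_iff {Ω : Variant S A} {lam : ℕ} (hlam : 0 < lam) (ρ : ℕ → S × A)
    (n : ℕ) : track (shiftWindow lam) (fun _ => none) ρ n ∈ badWindows Ω lam ↔
      lam ≤ n ∧ ¬ GoodWindow Ω lam (suffix ρ (n - lam)) := by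
  constructor
  · rintro ⟨ρ', h, hbad⟩
    have hn : lam ≤ n := by
      by_contra hn
      -- Slot 0 is filled last in time, so it is still empty when `n < lam`.
      have := h ⟨0, hlam⟩
      rw [track_shiftWindow, if_neg (by simpa using hn)] at this
      simp at this
    refine ⟨hn, fun hgood => hbad (hgood.congr fun i hi => ?_)⟩
    have := h ⟨i, hi⟩
    rw [track_shiftWindow, if_pos (by simp only; omega)] at this
    rw [← Option.some.inj this, suffix, Nat.sub_add_comm hn]
  · rintro ⟨hn, hbad⟩
    refine ⟨_, fun i => ?_, hbad⟩
    rw [track_shiftWindow, if_pos (by omega), suffix, Nat.sub_add_comm hn]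

theorem mem_FW_iff_coBuchi {M : MDP S A} {Ω : Variant S A} {lam : ℕ} (hlam : 0 < lam)
    {ρ : ℕ → S × A} (hρ : ρ ∈ M.Runs) : ρ ∈ M.FW Ω lam ↔
      ρ ∈ coBuchi (shiftWindow lam) (fun _ => none) (badWindows Ω lam) := by
  rw [mem_FW_iff, and_iff_right hρ]
  constructor
  · rintro ⟨i, hi⟩
    -- The shift by `lam` accounts for the delay of the verdict.
    refine ⟨i + lam, fun n hn h => ?_⟩
    exact ((track_mem_badWindows_iff hlam ρ n).1 h).2 (hi _ (by omega))
  · rintro ⟨m, hm⟩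
    refine ⟨m, fun j hj => ?_⟩
    have := mt (track_mem_badWindows_iff hlam ρ (j + lam)).2 (hm _ (by omega))
    simpa using this

/-- The update function of the automaton that remembers whether a bad state has been visited. -/
def recordBad (u : Q → S × A → Q) (Bad : Set Q) (p : Q × Prop) (x : S × A) : Q × Prop :=
  (u p.1 x, p.2 ∨ u p.1 x ∈ Bad)

theorem track_recordBad (u : Q → S × A → Q) (q₀ : Q) (Bad : Set Q) (ρ : ℕ → S × A) (n : ℕ) :
    (track (recordBad u Bad) (q₀, q₀ ∈ Bad) ρ n).1 = track u q₀ ρ n ∧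
      ((track (recordBad u Bad) (q₀, q₀ ∈ Bad) ρ n).2 ↔ ∃ k ≤ n, track u q₀ ρ k ∈ Bad) := by
  induction n with
  | zero => simp [track]
  | succ n ih =>
    simp only [track, recordBad, ih.1, ih.2, true_and]
    constructor
    · rintro (⟨k, hk, h⟩ | h)
      · exact ⟨k, by omega, h⟩
      · exact ⟨n + 1, le_rfl, h⟩
    · rintro ⟨k, hk, h⟩
      obtain hk | rfl := Nat.le_succ_iff.1 hk
      · exact Or.inl ⟨k, hk, h⟩
      · exact Or.inr h

/-- Once raised, the flag stays raised, so it is up finitely often only if it is never up. -/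
theorem mem_coBuchi_recordBad (u : Q → S × A → Q) (q₀ : Q) (Bad : Set Q) (ρ : ℕ → S × A) :
    ρ ∈ coBuchi (recordBad u Bad) (q₀, q₀ ∈ Bad) {p | p.2} ↔ ∀ n, track u q₀ ρ n ∉ Bad := by
  constructor
  · rintro ⟨m, hm⟩ n hn
    exact hm (max m n) (le_max_left _ _)
      ((track_recordBad u q₀ Bad ρ _).2.2 ⟨n, le_max_right _ _, hn⟩)
  · refine fun h => ⟨0, fun n _ hn => ?_⟩
    obtain ⟨k, -, hk⟩ := (track_recordBad u q₀ Bad ρ n).2.1 hn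
    exact h k hk

theorem mem_DFW_iff_coBuchi {M : MDP S A} {Ω : Variant S A} {lam : ℕ} (hlam : 0 < lam)
    {ρ : ℕ → S × A} (hρ : ρ ∈ M.Runs) : ρ ∈ M.DFW Ω lam ↔
      ρ ∈ coBuchi (recordBad (shiftWindow lam) (badWindows Ω lam))
        (fun _ => none, (fun _ => none) ∈ badWindows Ω lam) {p | p.2} := by
  rw [mem_DFW_iff, and_iff_right hρ, mem_coBuchi_recordBad]
  constructor
  · exact fun h n hn => ((track_mem_badWindows_iff hlam ρ n).1 hn).2 (h _)
  · intro h j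
    simpa using mt (track_mem_badWindows_iff hlam ρ (j + lam)).2 (h _)

end MDP

theorem theorem4p4 {S A : Type*} [Finite S] [Finite A]
    [MeasurableSpace S] [MeasurableSpace A]
    [DiscreteMeasurableSpace S] [DiscreteMeasurableSpace A]
    (M : MDP S A) (s : S) (Ω : MDP.Variant S A) (lam : ℕ) (hlam : 0 < lam)
    (E : Set (ℕ → S × A)) (hE : E = M.DFW Ω lam ∨ E = M.FW Ω lam)
    (α : ℚ) (hα0 : 0 ≤ α) (hα1 : α ≤ 1)
    (hσ : ∃ σ : M.Strategy, (α : ℝ) ≤ (σ.law s).real E) :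
    ∃ σ' : M.Strategy, σ'.IsPure ∧ σ'.IsFiniteMemory ∧ (α : ℝ) ≤ (σ'.law s).real E := by
  obtain ⟨σ, hσ⟩ := hσ
  have key {Q : Type _} [Finite Q] (u : Q → S × A → Q) (q₀ : Q) (Bad : Set Q)
      (h : ∀ ρ ∈ M.Runs, ρ ∈ E ↔ ρ ∈ MDP.coBuchi u q₀ Bad) :
      ∃ σ' : M.Strategy, σ'.IsPure ∧ σ'.IsFiniteMemory ∧ (α : ℝ) ≤ (σ'.law s).real E := by
    -- Agreement on runs suffices, as every strategy produces a run almost surely.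
    have hE (τ : M.Strategy) : τ.law s E = τ.law s (MDP.coBuchi u q₀ Bad) :=
      measure_congr <| by
        filter_upwards [τ.ae_mem_runs s] with ρ hρ using propext (h ρ hρ)
    obtain ⟨σ', hp, hf, hle⟩ := MDP.exists_pure_finiteMemory_coBuchi u q₀ Bad s σ
    refine ⟨σ', hp, hf, hσ.trans (ENNReal.toReal_mono (measure_ne_top _ _) ?_)⟩
    rwa [hE, hE]
  obtain rfl | rfl := hE
  · exact key _ _ _ fun ρ hρ => MDP.mem_DFW_iff_coBuchi hlam hρ
  · exact key _ _ _ fun ρ hρ => MDP.mem_FW_iff_coBuchi hlam hρ
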